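/- **Setting.** Let $\mathbf M:\mathbb Z_+\times\mathbb Z_+\to\{0,1\}$ be a transition matrix. Let $\mathcal B_0$ be the set of $i$ with $\mathbf M(i,j)=1$ for some $j$, and $\mathcal B_n$ the set of $i$ with $\mathbf M(i,j)=1$ for some $j\in\mathcal B_{n-1}$. Assume $\mathbf M$ is *finitely primitive*: there are a finite set $\mathbb F\subseteq\mathbb Z_+$ and an integer $K_0\ge 0$ (both fixed from now on) such that for all $i,j\in\bigcap_n\mathcal B_n$ there are $\ell_1,\dots,\ell_{K_0}\in\mathbb F$ with $\mathbf M(i,\ell_1)\mathbf M(\ell_1,\ell_2)\cdots\mathbf M(\ell_{K_0},j)=1$. Let $$\boldsymbol\Sigma=\{\mathbf x=(x_0,x_1,\dots)\in\mathbb Z_+^{\mathbb Z_+}:\mathbf M(x_j,x_{j+1})=1\ \ \forall j\},\qquad [i]=\{\mathbf x\in\boldsymbol\Sigma:x_0=i\},$$ with left shift $\sigma$ and, for a fixed $\lambda\in(0,1)$, metric $d(\mathbf x,\mathbf y)=\lambda^{k}$, $k=\min\{j:x_j\ne y_j\}$ (and $d(\mathbf x,\mathbf x)=0$). Assume $\bigcup_{i\in\mathbb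 F}[i]\neq\emptyset$, and put $I_{\mathbb F}=\max\mathbb F$. For an integer $I\ge0$ let $\Sigma_I=\{\mathbf x\in\boldsymbol\Sigma:x_j\le I\ \ \forall j\}$. Let $A:\boldsymbol\Sigma\to\mathbb R$ be bounded above and locally Hölder continuous: there is $H_A>0$ with $$\mathrm{Var}_k(A):=\sup_{d(\mathbf x,\mathbf y)\le\lambda^k}[A(\mathbf x)-A(\mathbf y)]\le H_A\lambda^k\quad\text{for all }k\ge1,$$ and put $\mathrm{Var}(A)=\sum_{k\ge1}\mathrm{Var}_k(A)$. Let $\mathcal M_\sigma$ be the set of $\sigma$-invariant Borel probability measures on $\boldsymbol\Sigma$; integrals of $A$ take values in $[-\infty,\infty)$. Define $$\beta_A=\sup_{\mu\in\mathcal M_\sigma}\int A\,d\mu,\qquad \beta_A(I)=\max_{\mu\in\mathcal M_\sigma,\ \mathrm{supp}\,\mu\subseteq\Sigma_I}\int A\,d\mu\quad(I\ge I_{\mathbb F}).$$ A measure $\mu\in\mathcal M_\sigma$ is *$A$-maximizing* if $\int A\,d\mu=\beta_A$. Let $\Omega(A,I)$ be the set of $\mathbf x\in\Sigma_I$ such that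 for every $\epsilon>0$ there are $\mathbf y\in\Sigma_I$ and $n>0$ with $$d(\mathbf x,\mathbf y)<\epsilon,\quad d(\mathbf x,\sigma^n(\mathbf y))<\epsilon,\quad \Big|\sum_{j=0}^{n-1}\big(A(\sigma^j(\mathbf y))-\beta_A(I)\big)\Big|<\epsilon .$$ **Theorem.** Assume there is an integer $\hat I>I_{\mathbb F}$ such that $$\sup A|_{\bigcup_{i>\hat I}[i]}<\inf A|_{\bigcup_{i\in\mathbb F}[i]}-\Big[\mathrm{Var}(A)+K_0\Big(\sup A-\inf A|_{\bigcup_{i\in\mathbb F}[i]}\Big)\Big],$$ where the supremum over the empty set is $-\infty$. Then $\beta_A=\beta_A(\hat I)$, where the maximum defining $\beta_A(\hat I)$ is attained. Moreover, $\mu\in\mathcal M_\sigma$ is $A$-maximizing if and only if $\mathrm{supp}\,\mu\subseteq\Omega(A,\hat I)$. -/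

import Mathlib

open MeasureTheory
open scoped ENNReal

noncomputable section

namespace MarkovShift

/-- For a transition matrix `M` with entries in `{0, 1}` on the alphabet `ℕ` (written as the relation
`M i j`, meaning that the `(i, j)` entry is `1`), `admissible M n` is the set `B_n` of symbols:
`B_0 = {i : M(i, j) = 1 for some j}`, `B_{n+1} = {i : M(i, j) = 1 for some j ∈ B_n}`. -/
def admissible (M : ℕ → ℕ → Prop) : ℕ → Set ℕ
  | 0 => {i | ∃ j, M i j}
  | n + 1 => {i | ∃ j ∈ admissible M n, M i j}

/-- `M` is finitely primitive with finite symbol set `F` and integer `K₀ ≥ 0`: any two symbols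
`i, j ∈ ⋂ B_n` are joined by an admissible word `i ℓ₁ ⋯ ℓ_{K₀} j` with all `ℓ_k ∈ F`. -/
def FinitelyPrimitiveWith (M : ℕ → ℕ → Prop) (F : Finset ℕ) (K₀ : ℕ) : Prop :=
  ∀ i ∈ ⋂ n, admissible M n, ∀ j ∈ ⋂ n, admissible M n,
    ∃ l : List ℕ, l.length = K₀ ∧ (∀ a ∈ l, a ∈ F) ∧ List.IsChain M (i :: (l ++ [j]))

/-- The one-sided Markov subshift `Σ` of the matrix `M`. Its topology and its (Borel) σ-algebra are
those induced by the product `ℕ → ℕ` of discrete spaces; see `isOpen_iff_shiftDist`. -/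
abbrev Shift (M : ℕ → ℕ → Prop) : Type :=
  {x : ℕ → ℕ // ∀ j, M (x j) (x (j + 1))}

variable {M : ℕ → ℕ → Prop}

/-- The left shift map `σ`. -/
def shiftMap (x : Shift M) : Shift M :=
  ⟨fun j => x.1 (j + 1), fun j => x.2 (j + 1)⟩

/-- The metric `d(x, y) = lam ^ k`, `k = min {j : x_j ≠ y_j}` (and `d(x, x) = 0`). -/
def shiftDist (lam : ℝ) (x y : Shift M) : ℝ :=
  open Classical in if x = y then 0 else lam ^ PiNat.firstDiff x.1 y.1

/-- For `0 < lam < 1` the topology of `Shift M` is the one given by the metric `shiftDist lam`. -/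
theorem isOpen_iff_shiftDist {lam : ℝ} (h0 : 0 < lam) (h1 : lam < 1) (s : Set (Shift M)) :
    IsOpen s ↔ ∀ x ∈ s, ∃ ε > 0, ∀ y, shiftDist lam x y < ε → y ∈ s := by
  classical
  constructor
  · intro hs x hx
    obtain ⟨t, ht, rfl⟩ := isOpen_induced_iff.1 hs
    obtain ⟨v, ⟨z, n, rfl⟩, hxv, hvt⟩ :=
      (PiNat.isTopologicalBasis_cylinders (fun _ : ℕ => ℕ)).exists_subset_of_mem_open hx ht
    refine ⟨lam ^ n, pow_pos h0 n, fun y hy => hvt ?_⟩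
    by_cases hxy : x = y
    · exact hxy ▸ hxv
    · rw [shiftDist, if_neg hxy] at hy
      have hn : n < PiNat.firstDiff x.1 y.1 := (pow_lt_pow_iff_right_of_lt_one₀ h0 h1).1 hy
      intro i hi
      rw [← hxv i hi]
      exact (PiNat.apply_eq_of_lt_firstDiff (hi.trans hn)).symm
  · intro h
    rw [isOpen_iff_mem_nhds]
    intro x hx
    obtain ⟨ε, hε, H⟩ := h x hx
    obtain ⟨n, hn⟩ := exists_pow_lt_of_lt_one hε h1
    have ho : IsOpen (Subtype.val ⁻¹' PiNat.cylinder (E := fun _ : ℕ => ℕ) x.1 n : Set (Shift M)) :=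
      (PiNat.isOpen_cylinder (fun _ : ℕ => ℕ) x.1 n).preimage continuous_subtype_val
    refine Filter.mem_of_superset (ho.mem_nhds (PiNat.self_mem_cylinder x.1 n)) fun y hy => H y ?_
    by_cases hxy : x = y
    · rw [shiftDist, if_pos hxy]; exact hε
    · rw [shiftDist, if_neg hxy]
      have hne : y.1 ≠ x.1 := fun e => hxy (Subtype.ext e.symm)
      have hle : n ≤ PiNat.firstDiff y.1 x.1 := (PiNat.mem_cylinder_iff_le_firstDiff hne n).1 hy
      rw [PiNat.firstDiff_comm] at hle
      exact (pow_le_pow_of_le_one h0.le h1.le hle).trans_lt hn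

/-- The cylinder `[i] = {x ∈ Σ : x_0 = i}`. -/
def cylinder (M : ℕ → ℕ → Prop) (i : ℕ) : Set (Shift M) := {x | x.1 0 = i}

/-- The union of the cylinders `[i]`, `i ∈ F`. -/
def cylinders (M : ℕ → ℕ → Prop) (F : Finset ℕ) : Set (Shift M) := ⋃ i ∈ F, cylinder M i

/-- The union of the cylinders `[i]`, `i > I`. -/
def cylindersAbove (M : ℕ → ℕ → Prop) (I : ℕ) : Set (Shift M) := ⋃ i > I, cylinder M i

/-- The subshift `Σ_I ⊆ Σ` of the sequences with all symbols in `{0, …, I}`. -/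
def finiteShift (M : ℕ → ℕ → Prop) (I : ℕ) : Set (Shift M) := {x | ∀ j, x.1 j ≤ I}

/-- `Var_k(A) = sup {A x - A y : d(x, y) ≤ lam ^ k}`, with values in `[0, ∞]`. (The pairs `x = y`
contribute `0`, so replacing negative differences by `0` does not change the supremum.) -/
def variation (lam : ℝ) (A : Shift M → ℝ) (k : ℕ) : ℝ≥0∞ :=
  ⨆ (x : Shift M) (y : Shift M) (_ : shiftDist lam x y ≤ lam ^ k), ENNReal.ofReal (A x - A y)

/-- `Var(A) = ∑_{k ≥ 1} Var_k(A)`. -/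
def totalVariation (lam : ℝ) (A : Shift M → ℝ) : ℝ≥0∞ := ∑' k : ℕ, variation lam A (k + 1)

/-- Local Hölder continuity: `Var_k(A) ≤ H * lam ^ k` for all `k ≥ 1`, for some constant `H > 0`. -/
def LocallyHolder (lam : ℝ) (A : Shift M → ℝ) : Prop :=
  ∃ H : ℝ, 0 < H ∧ ∀ k : ℕ, 1 ≤ k → variation lam A k ≤ ENNReal.ofReal (H * lam ^ k)

/-- The `σ`-invariant Borel probability measures on `Σ`. -/
def invariantProbs (M : ℕ → ℕ → Prop) : Set (Measure (Shift M)) :=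
  {μ | IsProbabilityMeasure μ ∧ MeasurePreserving (shiftMap (M := M)) μ μ}

/-- The integral `∫ A dμ = ∫ A⁺ dμ - ∫ A⁻ dμ ∈ [-∞, ∞)` of a function that is bounded above; it
is `-∞` when `A⁻` is not integrable. -/
def extIntegral (A : Shift M → ℝ) (μ : Measure (Shift M)) : EReal :=
  ((∫⁻ x, ENNReal.ofReal (A x) ∂μ : ℝ≥0∞) : EReal) -
    ((∫⁻ x, ENNReal.ofReal (-A x) ∂μ : ℝ≥0∞) : EReal)

/-- The ergodic maximizing value `β_A`. -/
def beta (A : Shift M → ℝ) : EReal := ⨆ μ ∈ invariantProbs M, extIntegral A μ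

/-- `A`-maximizing probabilities. -/
def IsMaximizing (A : Shift M → ℝ) (μ : Measure (Shift M)) : Prop :=
  μ ∈ invariantProbs M ∧ extIntegral A μ = beta A

/-- The `σ`-invariant Borel probability measures whose support lies in `Σ_I`. -/
def finiteProbs (M : ℕ → ℕ → Prop) (I : ℕ) : Set (Measure (Shift M)) :=
  {μ | μ ∈ invariantProbs M ∧ μ.support ⊆ finiteShift M I}

/-- The ergodic maximizing value `β_A(I)` of the restriction of `A` to `Σ_I`. -/
def betaFinite (A : Shift M → ℝ) (I : ℕ) : EReal := ⨆ μ ∈ finiteProbs M I, extIntegral A μ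

/-- The set `Ω(A, I) ⊆ Σ_I` of non-wandering points with respect to the restriction of `A` to
`Σ_I`; `birkhoffSum shiftMap f n y` is `S_n f(y) = ∑_{j < n} f(σ^j y)`. -/
def nonWandering (lam : ℝ) (A : Shift M → ℝ) (I : ℕ) : Set (Shift M) :=
  {x | x ∈ finiteShift M I ∧ ∀ ε : ℝ, 0 < ε → ∃ y ∈ finiteShift M I, ∃ n : ℕ, 0 < n ∧
    shiftDist lam x y < ε ∧ shiftDist lam x (shiftMap^[n] y) < ε ∧
    |birkhoffSum shiftMap (fun z => A z - (betaFinite A I).toReal) n y| < ε}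

end MarkovShift

end

/-! Let `c` be the supremum of the averages of `A` over periodic orbits in `Σ_Î`, and let `C` be the
bracket in the gap hypothesis. The key estimate is `S_n(A - c) ≤ C` for all words
(`birkhoffSum_sub_periodicValue_le`). A word with symbols at most `Î` closes up to a periodic orbit
through `K₀` symbols of `F`, at cost at most `C`. A symbol above `Î` loses at least `C`, which pays
for the word before it.

Hence `u(x) = sup {S_n(A - c)(y) : σ^n y = x}` takes values in `[0, C]`. It is continuous, and the
defect `R = c - A - u + u ∘ σ` is nonnegative. Integrating `R` gives `∫ A dμ ≤ c` for every
invariant `μ`, and weak compactness on `Σ_Î` gives a measure attaining `c`; so both maximal values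
equal `c`.

Equality holds exactly when `R = 0` on the support (`extIntegral_eq_iff`). The strict gap makes `R >
0` at symbols above `Î`, so such a support lies in `Σ_Î`, and Poincaré recurrence puts it in `Ω(A,
Î)`. Conversely, the identity `S_n(A - c) = u ∘ σ^n - u - S_n R` forces `R = 0` on `Ω(A, Î)`. -/

open Filter Topology

namespace MarkovShift

variable {M : ℕ → ℕ → Prop} {lam : ℝ} {A : Shift M → ℝ}

/-! ### Agreement of initial words and the topology of the shift -/

/-- The sequences `x` and `y` agree in their first `n` symbols. -/
def Agree (n : ℕ) (x y : Shift M) : Prop := ∀ i < n, x.1 i = y.1 i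

theorem Agree.symm {n : ℕ} {x y : Shift M} (h : Agree n x y) : Agree n y x :=
  fun i hi => (h i hi).symm

theorem shiftMap_iterate_apply (n j : ℕ) (x : Shift M) :
    (shiftMap^[n] x).1 j = x.1 (j + n) := by
  induction n generalizing x with
  | zero => rfl
  | succ n ih =>
    rw [Function.iterate_succ_apply, ih]
    exact congrArg x.1 (by ring)

theorem Agree.shiftMap_iterate {n m : ℕ} {x y : Shift M} (h : Agree (n + m) x y) :
    Agree n (shiftMap^[m] x) (shiftMap^[m] y) := by
  intro i hi
  rw [shiftMap_iterate_apply, shiftMap_iterate_apply]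
  exact h _ (by omega)

theorem Agree.shiftDist_le (h0 : 0 < lam) (h1 : lam < 1) {k : ℕ} {x y : Shift M}
    (h : Agree k x y) : shiftDist lam x y ≤ lam ^ k := by
  unfold shiftDist
  split_ifs with hxy
  · positivity
  · refine pow_le_pow_of_le_one h0.le h1.le ?_
    by_contra! hlt
    exact PiNat.apply_firstDiff_ne (fun e => hxy (Subtype.ext e)) (h _ hlt)

theorem isOpen_setOf_agree (x : Shift M) (n : ℕ) : IsOpen {y : Shift M | Agree n x y} := by
  have : {y : Shift M | Agree n x y} =
      Subtype.val ⁻¹' PiNat.cylinder (E := fun _ : ℕ => ℕ) x.1 n := by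
    ext y
    exact ⟨fun h i hi => (h i hi).symm, fun h i hi => (h i hi).symm⟩
  rw [this]
  exact (PiNat.isOpen_cylinder (fun _ : ℕ => ℕ) x.1 n).preimage continuous_subtype_val

@[fun_prop]
theorem continuous_shiftMap : Continuous (shiftMap (M := M)) :=
  continuous_induced_rng.2
    (continuous_pi fun j => (continuous_apply (j + 1)).comp continuous_subtype_val)

theorem continuous_of_agree {f : Shift M → ℝ} {τ : ℕ → ℝ} (hτ : Tendsto τ atTop (𝓝 0))
    (h : ∀ k, 1 ≤ k → ∀ x y, Agree k x y → f x - f y ≤ τ k) : Continuous f := by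
  rw [continuous_iff_continuousAt]
  intro x
  rw [ContinuousAt, Metric.tendsto_nhds]
  intro ε hε
  obtain ⟨k, hk, hk1⟩ := ((hτ.eventually (gt_mem_nhds hε)).and (eventually_ge_atTop 1)).exists
  filter_upwards [(isOpen_setOf_agree x k).mem_nhds (show Agree k x x from fun _ _ => rfl)]
    with y hy
  rw [Real.dist_eq, abs_sub_lt_iff]
  exact ⟨(h k hk1 _ _ (Agree.symm hy)).trans_lt hk, (h k hk1 _ _ hy).trans_lt hk⟩

/-! ### Variations -/

theorem summable_variation (h0 : 0 < lam) (h1 : lam < 1) (hA : LocallyHolder lam A) :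
    Summable fun k : ℕ => (variation lam A (k + 1)).toReal := by
  obtain ⟨H, hH, hV⟩ := hA
  refine Summable.of_nonneg_of_le (fun _ => ENNReal.toReal_nonneg) (fun k => ?_)
    (((summable_geometric_of_lt_one h0.le h1).mul_left (H * lam)))
  calc _ ≤ H * lam ^ (k + 1) := ENNReal.toReal_le_of_le_ofReal (by positivity) (hV _ (by omega))
    _ = _ := by ring

theorem sub_le_variation (h0 : 0 < lam) (h1 : lam < 1) (hA : LocallyHolder lam A) {k : ℕ}
    (hk : 1 ≤ k) {x y : Shift M} (h : Agree k x y) :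
    A x - A y ≤ (variation lam A k).toReal := by
  obtain ⟨H, hH, hV⟩ := hA
  refine ENNReal.ofReal_le_iff_le_toReal ((hV k hk).trans_lt ENNReal.ofReal_lt_top).ne |>.1 ?_
  exact le_iSup_of_le x (le_iSup_of_le y (le_iSup_of_le (h.shiftDist_le h0 h1) le_rfl))

theorem continuous_of_locallyHolder (h0 : 0 < lam) (h1 : lam < 1) (hA : LocallyHolder lam A) :
    Continuous A := by
  refine continuous_of_agree (τ := fun k => (variation lam A k).toReal) ?_
    fun k hk x y h => sub_le_variation h0 h1 hA hk h
  exact (tendsto_add_atTop_iff_nat 1).1 (summable_variation h0 h1 hA).tendsto_atTop_zero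

/-- The tail `∑_{j > k} Var_j(A)` of the total variation. -/
noncomputable def variationTail (lam : ℝ) (A : Shift M → ℝ) (k : ℕ) : ℝ :=
  ∑' i : ℕ, (variation lam A (i + k + 1)).toReal

theorem tendsto_variationTail : Tendsto (variationTail lam A) atTop (𝓝 0) :=
  tendsto_sum_nat_add fun i => (variation lam A (i + 1)).toReal

theorem variationTail_zero (hA : LocallyHolder lam A) :
    variationTail lam A 0 = (totalVariation lam A).toReal := by
  obtain ⟨H, hH, hV⟩ := hA
  rw [totalVariation, ENNReal.tsum_toReal_eq
    fun k => ((hV _ (by omega)).trans_lt ENNReal.ofReal_lt_top).ne]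
  rfl

/-- After `j` shifts the points still agree in `n + k - j` symbols, so the `j`-th terms differ by at
most `Var_{n+k-j}(A)`. Read backwards, these bounds are the first `n` terms of the tail. -/
theorem birkhoffSum_sub_le (h0 : 0 < lam) (h1 : lam < 1) (hA : LocallyHolder lam A)
    {n k : ℕ} {x y : Shift M} (h : Agree (n + k) x y) :
    birkhoffSum shiftMap A n x - birkhoffSum shiftMap A n y ≤ variationTail lam A k := by
  rw [birkhoffSum, birkhoffSum, ← Finset.sum_sub_distrib, ← Finset.sum_range_reflect]
  have hs : Summable fun i : ℕ => (variation lam A (i + k + 1)).toReal :=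
    (summable_nat_add_iff k).2 (summable_variation h0 h1 hA)
  refine (Finset.sum_le_sum fun i hi => ?_).trans
    (hs.sum_le_tsum (Finset.range n) fun _ _ => ENNReal.toReal_nonneg)
  have hi' := Finset.mem_range.1 hi
  refine sub_le_variation h0 h1 hA (by omega) (Agree.shiftMap_iterate ?_)
  rwa [show i + k + 1 + (n - 1 - i) = n + k by omega]

/-! ### Closing words to periodic points -/

theorem apply_mem_admissible (x : Shift M) (j : ℕ) : x.1 j ∈ ⋂ n, admissible M n := by
  rw [Set.mem_iInter]
  intro n
  induction n generalizing j with
  | zero => exact ⟨_, x.2 j⟩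
  | succ n ih => exact ⟨_, ih (j + 1), x.2 j⟩

theorem FinitelyPrimitiveWith.exists_path {F : Finset ℕ} {K₀ : ℕ}
    (hM : FinitelyPrimitiveWith M F K₀) {i j : ℕ} (hi : i ∈ ⋂ n, admissible M n)
    (hj : j ∈ ⋂ n, admissible M n) :
    ∃ f : ℕ → ℕ, f 0 = i ∧ f (K₀ + 1) = j ∧ (∀ k ≤ K₀, M (f k) (f (k + 1))) ∧
      ∀ k < K₀, f (k + 1) ∈ F := by
  obtain ⟨l, rfl, hF, hl⟩ := hM i hi j hj
  refine ⟨fun k => (i :: (l ++ [j])).getD k 0, by simp, by simp, fun k hk => ?_, fun k hk => ?_⟩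
  · have := List.isChain_iff_getElem.1 hl k (by simp; omega)
    beta_reduce
    rwa [List.getD_eq_getElem _ _ (by simp; omega), List.getD_eq_getElem _ _ (by simp; omega)]
  · beta_reduce
    rw [List.getD_eq_getElem _ _ (by simp; omega)]
    apply hF
    simp [List.getElem_append_left hk]

/-- The word `y_0 ⋯ y_{m-1}` is closed by a word in `F` to a point of period `m + K₀`. -/
theorem FinitelyPrimitiveWith.exists_periodic {F : Finset ℕ} {K₀ : ℕ}
    (hM : FinitelyPrimitiveWith M F K₀) (y : Shift M) {m : ℕ} (hm : 0 < m) :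
    ∃ p : Shift M, Agree m y p ∧ shiftMap^[m + K₀] p = p ∧
      (∀ j, (∃ i < m, p.1 j = y.1 i) ∨ p.1 j ∈ F) ∧ ∀ j < K₀, p.1 (m + j) ∈ F := by
  obtain ⟨f, hf0, hf1, hfM, hfF⟩ :=
    hM.exists_path (apply_mem_admissible y (m - 1)) (apply_mem_admissible y 0)
  -- One period: `y_0 ⋯ y_{m-1}`, then the interior of the connecting path. Its endpoint `f 0 =
  -- y_{m-1}` is already present, and `f (K₀ + 1) = y_0` starts the next period.
  set q : ℕ → ℕ := fun j => if j < m then y.1 j else f (j - m + 1) with hq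
  have hqlt : ∀ j < m, q j = y.1 j := fun j hj => if_pos hj
  have hqge : ∀ j, q (m + j) = f (j + 1) := fun j => by simp [hq]
  have hqM : ∀ j < m + K₀, M (q j) (q (j + 1)) := by
    intro j hj
    rcases lt_trichotomy (j + 1) m with h | h | h
    · rw [hqlt _ h, hqlt _ (by omega)]; exact y.2 j
    · rw [hqlt j (by omega), h, show m = m + 0 from rfl, hqge, ← show m - 1 = j by omega, ← hf0]
      exact hfM 0 (by omega)
    · obtain ⟨t, rfl⟩ : ∃ t, j = m + t := ⟨j - m, by omega⟩
      rw [add_assoc, hqge, hqge]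
      exact hfM (t + 1) (by omega)
  have hqN : q (m + K₀) = q 0 := by rw [hqge, hf1, hqlt 0 hm]
  have hN : 0 < m + K₀ := by omega
  refine ⟨⟨fun j => q (j % (m + K₀)), fun j => ?_⟩, fun i hi => ?_, ?_, fun j => ?_, fun j hj => ?_⟩
  · have hlt := Nat.mod_lt j hN
    have h := hqM _ hlt
    rcases Nat.lt_or_ge (j % (m + K₀) + 1) (m + K₀) with h' | h'
    · have : (j + 1) % (m + K₀) = j % (m + K₀) + 1 := by
        rw [← Nat.mod_add_mod, Nat.mod_eq_of_lt h']
      beta_reduce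
      rwa [this]
    · have h2 : j % (m + K₀) + 1 = m + K₀ := by omega
      have : (j + 1) % (m + K₀) = 0 := by
        rw [← Nat.mod_add_mod, h2, Nat.mod_self]
      beta_reduce
      rw [this, ← hqN]
      rwa [h2] at h
  · simp only
    rw [Nat.mod_eq_of_lt (by omega), hqlt i hi]
  · apply Subtype.ext
    funext j
    rw [shiftMap_iterate_apply]
    simp
  · have hlt := Nat.mod_lt j hN
    simp only
    rcases Nat.lt_or_ge (j % (m + K₀)) m with h' | h'
    · exact Or.inl ⟨_, h', hqlt _ h'⟩
    · right
      obtain ⟨t, ht⟩ : ∃ t, j % (m + K₀) = m + t := ⟨j % (m + K₀) - m, by omega⟩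
      rw [ht, hqge]
      exact hfF _ (by omega)
  · simp only
    rw [Nat.mod_eq_of_lt (by omega), hqge]
    exact hfF _ hj

theorem mem_cylinders {F : Finset ℕ} {x : Shift M} : x ∈ cylinders M F ↔ x.1 0 ∈ F := by
  simp [cylinders, cylinder]

theorem mem_cylindersAbove {I : ℕ} {x : Shift M} : x ∈ cylindersAbove M I ↔ I < x.1 0 := by
  simp [cylindersAbove, cylinder]

theorem iterate_mem_finiteShift {I : ℕ} {x : Shift M} (hx : x ∈ finiteShift M I) (n : ℕ) :
    shiftMap^[n] x ∈ finiteShift M I := fun j => by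
  rw [shiftMap_iterate_apply]
  exact hx _

theorem birkhoffSum_sub_const (f : Shift M → ℝ) (c : ℝ) (n : ℕ) (y : Shift M) :
    birkhoffSum shiftMap (fun z => f z - c) n y = birkhoffSum shiftMap f n y - n * c := by
  simp [birkhoffSum]

theorem birkhoffSum_le {f : Shift M → ℝ} {a : ℝ} {n : ℕ} {y : Shift M}
    (h : ∀ j < n, f (shiftMap^[j] y) ≤ a) : birkhoffSum shiftMap f n y ≤ n * a := by
  simpa [birkhoffSum] using Finset.sum_le_card_nsmul (Finset.range n) _ a fun j hj => h j (Finset.mem_range.1 hj)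

theorem le_birkhoffSum {f : Shift M → ℝ} {a : ℝ} {n : ℕ} {y : Shift M}
    (h : ∀ j < n, a ≤ f (shiftMap^[j] y)) : n * a ≤ birkhoffSum shiftMap f n y := by
  simpa [birkhoffSum] using Finset.card_nsmul_le_sum (Finset.range n) _ a fun j hj => h j (Finset.mem_range.1 hj)

/-- `A` oscillates by at most `Var_1(A)` on each `[i]`, and `F` is finite. Without this bound the
real `sInf` could be the default value `0`. -/
theorem bddBelow_image_cylinders (h0 : 0 < lam) (h1 : lam < 1) (hA : LocallyHolder lam A)
    (F : Finset ℕ) : BddBelow (A '' cylinders M F) := by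
  rw [cylinders, Set.image_iUnion₂]
  refine (F.finite_toSet.bddBelow_biUnion (S := fun i => A '' cylinder M i)).2 fun i _ => ?_
  rcases (cylinder M i).eq_empty_or_nonempty with h | ⟨x, hx⟩
  · simp [h]
  · refine ⟨A x - (variation lam A 1).toReal, ?_⟩
    rintro _ ⟨y, hy, rfl⟩
    have : Agree 1 x y := by
      intro j hj
      obtain rfl : j = 0 := by omega
      exact hx.trans hy.symm
    linarith [sub_le_variation h0 h1 hA le_rfl this]

/-! ### The maximal average over periodic orbits -/

/-- The averages of `A` over the periodic orbits in `Σ_I`. -/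
def periodicAverages (A : Shift M → ℝ) (I : ℕ) : Set ℝ :=
  {a | ∃ p ∈ finiteShift M I, ∃ N : ℕ, 0 < N ∧ shiftMap^[N] p = p ∧
    a = birkhoffSum shiftMap A N p / N}

/-- The supremum of the averages of `A` over the periodic orbits in `Σ_I`. -/
noncomputable def periodicValue (A : Shift M → ℝ) (I : ℕ) : ℝ := sSup (periodicAverages A I)

theorem le_sSup_of_mem_periodicAverages (hAbdd : BddAbove (Set.range A)) {I : ℕ} {a : ℝ}
    (ha : a ∈ periodicAverages A I) : a ≤ sSup (Set.range A) := by
  obtain ⟨p, -, N, hN, -, rfl⟩ := ha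
  have hN' : (0 : ℝ) < N := by exact_mod_cast hN
  rw [div_le_iff₀ hN', mul_comm]
  exact birkhoffSum_le fun j _ => le_csSup hAbdd ⟨_, rfl⟩

theorem birkhoffSum_le_mul_periodicValue (hAbdd : BddAbove (Set.range A)) {I N : ℕ}
    {p : Shift M} (hp : p ∈ finiteShift M I) (hN : 0 < N) (hper : shiftMap^[N] p = p) :
    birkhoffSum shiftMap A N p ≤ N * periodicValue A I := by
  have hN' : (0 : ℝ) < N := by exact_mod_cast hN
  rw [mul_comm, ← div_le_iff₀ hN']
  exact le_csSup ⟨_, fun _ => le_sSup_of_mem_periodicAverages hAbdd⟩ ⟨p, hp, N, hN, hper, rfl⟩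

/-- Closing a one-letter word taken from `F` gives an orbit that never leaves `F`. -/
theorem periodicAverages_nonempty {F : Finset ℕ} {K₀ : ℕ} (hM : FinitelyPrimitiveWith M F K₀)
    (hF : (cylinders M F).Nonempty) {I : ℕ} (hI : F.sup id ≤ I) :
    ∃ p ∈ finiteShift M I, ∃ N : ℕ, 0 < N ∧ shiftMap^[N] p = p ∧ ∀ j, p.1 j ∈ F := by
  obtain ⟨x, hx⟩ := hF
  rw [mem_cylinders] at hx
  obtain ⟨p, -, hper, hp, -⟩ := hM.exists_periodic x one_pos
  have hpF : ∀ j, p.1 j ∈ F := by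
    intro j
    rcases hp j with ⟨i, hi, h⟩ | h
    · obtain rfl : i = 0 := by omega
      rwa [h]
    · exact h
  exact ⟨p, fun j => (Finset.le_sup (f := id) (hpF j)).trans hI, _, by omega, hper, hpF⟩

theorem periodicValue_le (hAbdd : BddAbove (Set.range A)) {F : Finset ℕ} {K₀ : ℕ}
    (hM : FinitelyPrimitiveWith M F K₀)
    (hF : (cylinders M F).Nonempty) {I : ℕ} (hI : F.sup id ≤ I) :
    periodicValue A I ≤ sSup (Set.range A) := by
  obtain ⟨p, hp, N, hN, hper, -⟩ := periodicAverages_nonempty hM hF hI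
  exact csSup_le ⟨_, p, hp, N, hN, hper, rfl⟩ fun _ => le_sSup_of_mem_periodicAverages hAbdd

theorem sInf_cylinders_le {F : Finset ℕ} (hb : BddBelow (A '' cylinders M F)) {p : Shift M}
    {j : ℕ} (hp : p.1 j ∈ F) : sInf (A '' cylinders M F) ≤ A (shiftMap^[j] p) := by
  refine csInf_le hb ⟨_, ?_, rfl⟩
  rwa [mem_cylinders, shiftMap_iterate_apply, zero_add]

theorem sInf_le_periodicValue (h0 : 0 < lam) (h1 : lam < 1) (hA : LocallyHolder lam A)
    (hAbdd : BddAbove (Set.range A)) {F : Finset ℕ} {K₀ : ℕ}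
    (hM : FinitelyPrimitiveWith M F K₀)
    (hF : (cylinders M F).Nonempty) {I : ℕ} (hI : F.sup id ≤ I) :
    sInf (A '' cylinders M F) ≤ periodicValue A I := by
  obtain ⟨p, hp, N, hN, hper, hpF⟩ := periodicAverages_nonempty hM hF hI
  have hN' : (0 : ℝ) < N := by exact_mod_cast hN
  have hb := bddBelow_image_cylinders h0 h1 hA F
  refine le_of_mul_le_mul_left ?_ hN'
  exact (le_birkhoffSum fun j _ => sInf_cylinders_le hb (hpF j)).trans
    (birkhoffSum_le_mul_periodicValue hAbdd hp hN hper)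

/-- Birkhoff sums along words with symbols at most `I`. -/
theorem birkhoffSum_sub_le_of_word_le (h0 : 0 < lam) (h1 : lam < 1) (hA : LocallyHolder lam A)
    (hAbdd : BddAbove (Set.range A)) {F : Finset ℕ} {K₀ : ℕ}
    (hM : FinitelyPrimitiveWith M F K₀)
    {I : ℕ} (hI : F.sup id ≤ I) {n : ℕ} (hn : 0 < n) {y : Shift M} (hy : ∀ j < n, y.1 j ≤ I) :
    birkhoffSum shiftMap A n y - n * periodicValue A I ≤
      (totalVariation lam A).toReal +
        K₀ * (periodicValue A I - sInf (A '' cylinders M F)) := by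
  obtain ⟨p, hyp, hper, hp, hpF⟩ := hM.exists_periodic y hn
  have hpI : p ∈ finiteShift M I := by
    intro j
    rcases hp j with ⟨i, hi, h⟩ | h
    · exact h ▸ hy i hi
    · exact (Finset.le_sup (f := id) h).trans hI
  have hb := bddBelow_image_cylinders h0 h1 hA F
  have e1 := birkhoffSum_sub_le h0 h1 hA (n := n) (k := 0) hyp
  rw [variationTail_zero hA] at e1
  -- The whole period has sum at most `(n + K₀) c`; subtracting the connecting word, of sum at least
  -- `K₀ inf A`, bounds the part that shadows `y`.
  have e2 := birkhoffSum_le_mul_periodicValue hAbdd hpI (by omega) hper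
  rw [birkhoffSum_add] at e2
  have e3 : K₀ * sInf (A '' cylinders M F) ≤ birkhoffSum shiftMap A K₀ (shiftMap^[n] p) := by
    refine le_birkhoffSum fun j hj => ?_
    rw [← Function.iterate_add_apply]
    exact sInf_cylinders_le hb (by rw [add_comm]; exact hpF j hj)
  push_cast at e2
  linarith

/-- Birkhoff sums along all words, when the symbols above `I` are expensive. -/
theorem birkhoffSum_sub_periodicValue_le (h0 : 0 < lam) (h1 : lam < 1)
    (hA : LocallyHolder lam A) (hAbdd : BddAbove (Set.range A)) {F : Finset ℕ} {K₀ : ℕ}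
    (hM : FinitelyPrimitiveWith M F K₀) (hF : (cylinders M F).Nonempty)
    {I : ℕ} (hI : F.sup id ≤ I)
    (hgap : ∀ x ∈ cylindersAbove M I, A x ≤ sInf (A '' cylinders M F) -
      ((totalVariation lam A).toReal +
        K₀ * (sSup (Set.range A) - sInf (A '' cylinders M F)))) (n : ℕ) (y : Shift M) :
    birkhoffSum shiftMap A n y - n * periodicValue A I ≤ (totalVariation lam A).toReal +
        K₀ * (sSup (Set.range A) - sInf (A '' cylinders M F)) := by
  have hc1 := sInf_le_periodicValue h0 h1 hA hAbdd hM hF hI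
  have hc2 := periodicValue_le hAbdd hM hF hI
  have hV : 0 ≤ (totalVariation lam A).toReal := ENNReal.toReal_nonneg
  have hK : (0 : ℝ) ≤ K₀ := Nat.cast_nonneg _
  have hC : 0 ≤ K₀ * (sSup (Set.range A) - sInf (A '' cylinders M F)) :=
    mul_nonneg hK (by linarith)
  have good : ∀ n : ℕ, ∀ y : Shift M, (∀ j < n, y.1 j ≤ I) →
      birkhoffSum shiftMap A n y - n * periodicValue A I ≤ (totalVariation lam A).toReal +
        K₀ * (sSup (Set.range A) - sInf (A '' cylinders M F)) := by
    intro n y hy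
    rcases Nat.eq_zero_or_pos n with rfl | hn
    · simp only [birkhoffSum_zero, Nat.cast_zero]
      linarith
    · refine (birkhoffSum_sub_le_of_word_le h0 h1 hA hAbdd hM hI hn hy).trans ?_
      gcongr
  induction n using Nat.strong_induction_on generalizing y with
  | _ n ih =>
    by_cases hy : ∀ j < n, y.1 j ≤ I
    · exact good n y hy
    · push Not at hy
      classical
      -- Cut at the first symbol above `I`. The prefix contributes at most `C`, the large symbol at
      -- most `inf A - C - c ≤ -C`, and the remainder at most `C` by induction.
      obtain ⟨hm, hmI⟩ := Nat.find_spec hy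
      have hmin : ∀ j < Nat.find hy, y.1 j ≤ I := fun j hj => by
        have := Nat.find_min hy hj
        push Not at this
        exact this (hj.trans hm)
      generalize Nat.find hy = m at hm hmI hmin
      obtain ⟨t, rfl⟩ : ∃ t, n = m + 1 + t := ⟨n - (m + 1), by omega⟩
      have e1 := good m y hmin
      have e2 := ih t (by omega) (shiftMap^[m + 1] y)
      have e3 := hgap (shiftMap^[m] y) (by
        rw [mem_cylindersAbove, shiftMap_iterate_apply, zero_add]; exact hmI)
      rw [birkhoffSum_add, birkhoffSum_succ]
      push_cast
      linarith

/-! ### The sub-action -/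

/-- The values `S_n f(y)` of the Birkhoff sums along all the words ending at `x = σ^n y`. -/
def pastSums (f : Shift M → ℝ) (x : Shift M) : Set ℝ :=
  {a | ∃ n : ℕ, ∃ y : Shift M, shiftMap^[n] y = x ∧ a = birkhoffSum shiftMap f n y}

/-- The sub-action `u(x) = sup {S_n f(y) : σ^n y = x}`. -/
noncomputable def subaction (f : Shift M → ℝ) (x : Shift M) : ℝ := sSup (pastSums f x)

section Subaction

variable {f : Shift M → ℝ} {C : ℝ}

theorem bddAbove_pastSums (hC : ∀ n y, birkhoffSum shiftMap f n y ≤ C) (x : Shift M) :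
    BddAbove (pastSums f x) :=
  ⟨C, by rintro _ ⟨n, y, -, rfl⟩; exact hC n y⟩

theorem zero_mem_pastSums (f : Shift M → ℝ) (x : Shift M) : 0 ∈ pastSums f x :=
  ⟨0, x, rfl, by simp⟩

theorem subaction_nonneg (hC : ∀ n y, birkhoffSum shiftMap f n y ≤ C) (x : Shift M) :
    0 ≤ subaction f x :=
  le_csSup (bddAbove_pastSums hC x) (zero_mem_pastSums f x)

theorem subaction_le (hC : ∀ n y, birkhoffSum shiftMap f n y ≤ C) (x : Shift M) :
    subaction f x ≤ C :=
  csSup_le ⟨0, zero_mem_pastSums f x⟩ (by rintro _ ⟨n, y, -, rfl⟩; exact hC n y)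

/-- A past of `x` followed by `x` itself is a past of `σ x`. -/
theorem add_subaction_le (hC : ∀ n y, birkhoffSum shiftMap f n y ≤ C) (x : Shift M) :
    f x + subaction f x ≤ subaction f (shiftMap x) := by
  rw [← le_sub_iff_add_le']
  refine csSup_le ⟨0, zero_mem_pastSums f x⟩ ?_
  rintro _ ⟨n, y, rfl, rfl⟩
  rw [le_sub_iff_add_le, ← birkhoffSum_succ]
  exact le_csSup (bddAbove_pastSums hC _)
    ⟨n + 1, y, Function.iterate_succ_apply' _ _ _, rfl⟩

/-- Two points with the same first symbol have the same pasts. -/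
theorem exists_preimage_agree {n k : ℕ} {y x' : Shift M} (hk : 1 ≤ k)
    (h : Agree k (shiftMap^[n] y) x') :
    ∃ y' : Shift M, shiftMap^[n] y' = x' ∧ Agree (n + k) y y' := by
  have h' : ∀ i < k, y.1 (i + n) = x'.1 i := fun i hi => by
    rw [← shiftMap_iterate_apply]; exact h i hi
  -- Put the prefix `y_0 ⋯ y_{n-1}` before `x'`. The junction is admissible because `x'_0 = y_n`,
  -- which is where `1 ≤ k` enters.
  refine ⟨⟨fun j => if j < n then y.1 j else x'.1 (j - n), fun j => ?_⟩, ?_, fun j hj => ?_⟩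
  · rcases lt_trichotomy (j + 1) n with hj | hj | hj
    · simpa [hj, show j < n by omega] using y.2 j
    · have e := h' 0 hk
      rw [zero_add, ← hj] at e
      simpa [← hj, ← e] using y.2 j
    · have e : j + 1 - n = j - n + 1 := by omega
      simpa [show ¬ j < n by omega, show ¬ j + 1 < n by omega, e] using x'.2 (j - n)
  · apply Subtype.ext
    funext j
    rw [shiftMap_iterate_apply]
    simp
  · by_cases hjn : j < n
    · simp [hjn]
    · simp only [hjn, if_false]
      rw [← h' _ (by omega), Nat.sub_add_cancel (by omega)]

/-- Any past of `x` can be transplanted to a nearby `x'`, changing the Birkhoff sum by at most the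
tail of the variation, uniformly in the length of the past. -/
theorem continuous_subaction (h0 : 0 < lam) (h1 : lam < 1) (hA : LocallyHolder lam A) {c : ℝ}
    (hC : ∀ n y, birkhoffSum shiftMap (fun z => A z - c) n y ≤ C) :
    Continuous (subaction fun z => A z - c) := by
  refine continuous_of_agree (tendsto_variationTail (lam := lam) (A := A)) fun k hk x x' h => ?_
  rw [sub_le_iff_le_add']
  refine csSup_le ⟨0, zero_mem_pastSums _ x⟩ ?_
  rintro _ ⟨n, y, rfl, rfl⟩
  obtain ⟨y', rfl, hy⟩ := exists_preimage_agree hk h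
  have e1 := birkhoffSum_sub_le h0 h1 hA hy
  have e2 : _ ≤ subaction (fun z => A z - c) (shiftMap^[n] y') :=
    le_csSup (bddAbove_pastSums hC _) ⟨n, y', rfl, rfl⟩
  simp only [birkhoffSum_sub_const] at e2 ⊢
  linarith

end Subaction

/-! ### Invariant measures on compact systems -/

/-- The uniform probability measure on a periodic orbit. -/
theorem exists_invariant_of_periodic {K : Type*} [MeasurableSpace K] {T : K → K}
    (hT : Measurable T) {p : K} {N : ℕ} (hN : 0 < N) (hp : T^[N] p = p) :
    ∃ μ : ProbabilityMeasure K, (μ : Measure K).map T = μ ∧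
      ∀ f : K → ℝ, StronglyMeasurable f → ∫ x, f x ∂(μ : Measure K) = birkhoffSum T f N p / N := by
  have hN0 : (N : ℝ≥0∞) ≠ 0 := by exact_mod_cast hN.ne'
  have hN1 : (N : ℝ≥0∞) ≠ ⊤ := ENNReal.natCast_ne_top N
  set ν : Measure K := ∑ j ∈ Finset.range N, Measure.dirac (T^[j] p) with hν
  refine ⟨⟨(N : ℝ≥0∞)⁻¹ • ν, ⟨?_⟩⟩, ?_, fun f hf => ?_⟩
  · simp [hν, ENNReal.inv_mul_cancel hN0 hN1]
  · simp only [ProbabilityMeasure.coe_mk]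
    rw [Measure.map_smul]
    congr 1
    have h1 : ν.map T = ∑ j ∈ Finset.range N, Measure.dirac (T^[j + 1] p) := by
      rw [← Measure.mapₗ_apply_of_measurable hT, hν, map_sum]
      refine Finset.sum_congr rfl fun j _ => ?_
      rw [Measure.mapₗ_apply_of_measurable hT, Measure.map_dirac' hT, Function.iterate_succ_apply']
    rw [h1, hν]
    obtain ⟨n, rfl⟩ : ∃ n, N = n + 1 := ⟨N - 1, by omega⟩
    -- Pushing forward rotates the orbit: the last mass lands on `T^N p = p`.
    rw [Finset.sum_range_succ, Finset.sum_range_succ', hp]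
    rfl
  · simp only [ProbabilityMeasure.coe_mk]
    rw [integral_smul_measure, hν, integral_finsetSum_measure]
    · simp only [fun j => integral_dirac' f (T^[j] p) hf]
      simp [birkhoffSum, div_eq_inv_mul]
    · intro j _
      exact integrable_dirac' hf (by simp)

/-- On a compact system some invariant probability has an integral that dominates all the
averages over periodic orbits. -/
theorem exists_invariant_le_integral {K : Type*} [TopologicalSpace K] [MeasurableSpace K]
    [BorelSpace K] [CompactSpace K] [T2Space K] [HasOuterApproxClosed K] {T : K → K}
    (hT : Continuous T) (f : C(K, ℝ)) {p : K} {N : ℕ} (hN : 0 < N) (hp : T^[N] p = p) :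
    ∃ μ : ProbabilityMeasure K, (μ : Measure K).map T = μ ∧
      ∀ q : K, ∀ n : ℕ, 0 < n → T^[n] q = q →
        birkhoffSum T f n q / n ≤ ∫ x, f x ∂(μ : Measure K) := by
  have hS : IsClosed {μ : ProbabilityMeasure K | μ.map hT.measurable.aemeasurable = μ} :=
    isClosed_eq (ProbabilityMeasure.continuous_map hT) continuous_id
  have hmem : ∀ μ : ProbabilityMeasure K, μ.map hT.measurable.aemeasurable = μ ↔
      (μ : Measure K).map T = μ := fun μ => by
    exact Subtype.ext_iff
  obtain ⟨μ₀, h₀, -⟩ := exists_invariant_of_periodic hT.measurable hN hp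
  -- The invariant probabilities form a weakly compact set, nonempty because of the orbit of `p`, on
  -- which the integral of `f` is continuous.
  obtain ⟨μ, hμ, hmax⟩ := hS.isCompact.exists_isMaxOn ⟨μ₀, (hmem μ₀).2 h₀⟩
    (ProbabilityMeasure.continuous_integral_boundedContinuousFunction
      (BoundedContinuousFunction.mkOfCompact f)).continuousOn
  refine ⟨μ, (hmem μ).1 hμ, fun q n hn hq => ?_⟩
  obtain ⟨ν, hν, hi⟩ := exists_invariant_of_periodic hT.measurable hn hq
  rw [← hi f f.continuous.stronglyMeasurable]
  exact hmax ((hmem ν).2 hν)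

theorem isClosed_finiteShift (I : ℕ) : IsClosed (finiteShift M I) := by
  have : finiteShift M I = ⋂ j, (fun x : Shift M => x.1 j) ⁻¹' Set.Iic I := by
    ext x; simp [finiteShift]
  rw [this]
  exact isClosed_iInter fun j => (isClosed_discrete _).preimage
    ((continuous_apply j).comp continuous_subtype_val)

theorem isCompact_finiteShift (I : ℕ) : IsCompact (finiteShift M I) := by
  have hS : IsClosed {x : ℕ → ℕ | ∀ j, M (x j) (x (j + 1))} := by
    rw [Set.ofPred_forall]
    refine isClosed_iInter fun j => ?_
    have hc : Continuous fun x : ℕ → ℕ => (x j, x (j + 1)) :=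
      (continuous_apply j).prodMk (continuous_apply (j + 1))
    exact (isClosed_discrete {q : ℕ × ℕ | M q.1 q.2}).preimage hc
  rw [Subtype.isCompact_iff]
  have hP : IsCompact (Set.univ.pi fun _ : ℕ => Set.Iic I) :=
    isCompact_univ_pi fun _ => (Set.finite_Iic I).isCompact
  convert hP.inter_right hS using 1
  ext x
  constructor
  · rintro ⟨y, hy, rfl⟩
    exact ⟨fun j _ => hy j, y.2⟩
  · rintro ⟨h, hx⟩
    exact ⟨⟨x, hx⟩, fun j => h j trivial, rfl⟩

/-- Some invariant probability on `Σ_I` dominates all the averages over periodic orbits. -/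
theorem exists_finiteProbs_le_integral (hA : Continuous A) {I : ℕ} {p : Shift M}
    (hp : p ∈ finiteShift M I) {N : ℕ} (hN : 0 < N) (hper : shiftMap^[N] p = p) :
    ∃ μ ∈ finiteProbs M I, Integrable A μ ∧
      ∀ q ∈ finiteShift M I, ∀ n : ℕ, 0 < n → shiftMap^[n] q = q →
        birkhoffSum shiftMap A n q / n ≤ ∫ x, A x ∂μ := by
  have : CompactSpace (finiteShift M I) := isCompact_iff_compactSpace.1 (isCompact_finiteShift I)
  have : SecondCountableTopology (finiteShift M I) :=
    (Topology.IsInducing.subtypeVal.comp Topology.IsInducing.subtypeVal).secondCountableTopology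
  have : TopologicalSpace.MetrizableSpace (finiteShift M I) :=
    TopologicalSpace.metrizableSpace_of_t3_secondCountable _
  have hmaps : Set.MapsTo shiftMap (finiteShift M I) (finiteShift M I) :=
    fun x hx => iterate_mem_finiteShift hx 1
  set T : finiteShift M I → finiteShift M I := hmaps.restrict
  have hT : Continuous T := continuous_shiftMap.restrict hmaps
  have hcomm : ∀ n x, ((T^[n] x : finiteShift M I) : Shift M) = shiftMap^[n] x.1 := by
    intro n
    induction n with
    | zero => intro x; rfl
    | succ n ih => intro x; rw [Function.iterate_succ_apply, ih]; rfl
  let f : C(finiteShift M I, ℝ) := ⟨fun x => A x, hA.comp continuous_subtype_val⟩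
  obtain ⟨μ, hμ, hmax⟩ := exists_invariant_le_integral (p := ⟨p, hp⟩) hT f hN
    (Subtype.ext (by rw [hcomm]; exact hper))
  have hval : Measurable (Subtype.val : finiteShift M I → Shift M) := measurable_subtype_coe
  have hfin : (μ : Measure (finiteShift M I)).map Subtype.val (finiteShift M I)ᶜ = 0 := by
    rw [Measure.map_apply hval (isClosed_finiteShift I).measurableSet.compl]
    simp
  have hint : Integrable f (μ : Measure (finiteShift M I)) :=
    f.continuous.integrable_of_hasCompactSupport (HasCompactSupport.of_compactSpace _)
  refine ⟨(μ : Measure (finiteShift M I)).map Subtype.val,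
    ⟨⟨Measure.isProbabilityMeasure_map hval.aemeasurable, continuous_shiftMap.measurable, ?_⟩,
      Measure.support_subset_of_isClosed (isClosed_finiteShift I) hfin⟩, ?_, fun q hq n hn hn' => ?_⟩
  · rw [Measure.map_map continuous_shiftMap.measurable hval]
    conv_rhs => rw [← hμ, Measure.map_map hval hT.measurable]
    rfl
  · exact (integrable_map_measure hA.aestronglyMeasurable hval.aemeasurable).2 hint
  · rw [integral_map hval.aemeasurable hA.aestronglyMeasurable]
    convert hmax ⟨q, hq⟩ n hn (Subtype.ext (by rw [hcomm]; exact hn')) using 2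
    · simp [birkhoffSum, hcomm, f]
    · rfl

/-! ### Integrals against invariant measures -/

theorem extIntegral_of_integrable {μ : Measure (Shift M)} (h : Integrable A μ) :
    extIntegral A μ = ((∫ x, A x ∂μ : ℝ) : EReal) := by
  have h' : ∫⁻ x, ENNReal.ofReal (-A x) ∂μ ≠ ⊤ := h.neg.lintegral_lt_top.ne
  rw [integral_eq_lintegral_pos_part_sub_lintegral_neg_part h, extIntegral, EReal.coe_sub,
    EReal.coe_ennreal_toReal h.lintegral_lt_top.ne, EReal.coe_ennreal_toReal h']

theorem extIntegral_of_not_integrable (hAc : Continuous A) (hAbdd : BddAbove (Set.range A))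
    {μ : Measure (Shift M)} [IsProbabilityMeasure μ] (h : ¬ Integrable A μ) :
    extIntegral A μ = ⊥ := by
  obtain ⟨a, ha⟩ := hAbdd
  have h1 : ∫⁻ x, ENNReal.ofReal (A x) ∂μ < ⊤ := by
    refine (lintegral_mono (g := fun _ => ENNReal.ofReal a) fun x =>
      ENNReal.ofReal_le_ofReal (ha ⟨x, rfl⟩)).trans_lt ?_
    simp
  have h2 : ∫⁻ x, ENNReal.ofReal (-A x) ∂μ = ⊤ := by
    by_contra hne
    refine h ⟨hAc.aestronglyMeasurable, ?_⟩
    rw [hasFiniteIntegral_iff_norm]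
    have : ∀ x, ENNReal.ofReal ‖A x‖ = ENNReal.ofReal (A x) + ENNReal.ofReal (-A x) := by
      intro x
      rcases le_total 0 (A x) with hx | hx
      · rw [Real.norm_of_nonneg hx, ENNReal.ofReal_of_nonpos (neg_nonpos.2 hx), add_zero]
      · rw [Real.norm_of_nonpos hx, ENNReal.ofReal_of_nonpos hx, zero_add]
    simp_rw [this]
    rw [lintegral_add_left (by fun_prop)]
    exact ENNReal.add_lt_top.2 ⟨h1, lt_top_iff_ne_top.2 hne⟩
  rw [extIntegral, h2, EReal.coe_ennreal_top, EReal.sub_top]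

/-! ### The nonnegative defect of a sub-action and its zero set -/

section Cohomology

variable {u : Shift M → ℝ} {c C : ℝ} {μ : Measure (Shift M)}

theorem integrable_of_mem_Icc (hu : Continuous u) (hb : ∀ x, u x ∈ Set.Icc 0 C)
    [IsProbabilityMeasure μ] : Integrable u μ :=
  Integrable.of_bound hu.aestronglyMeasurable C
    (Eventually.of_forall fun x => by rw [Real.norm_of_nonneg (hb x).1]; exact (hb x).2)

theorem integral_defect (hμ : μ ∈ invariantProbs M) (hu : Continuous u)
    (hb : ∀ x, u x ∈ Set.Icc 0 C) (hi : Integrable A μ) :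
    Integrable (fun x => c - A x - u x + u (shiftMap x)) μ ∧
      ∫ x, (c - A x - u x + u (shiftMap x)) ∂μ = c - ∫ x, A x ∂μ := by
  have := hμ.1
  have h1 : Integrable u μ := integrable_of_mem_Icc hu hb
  have h2 : Integrable (fun x => u (shiftMap x)) μ :=
    integrable_of_mem_Icc (hu.comp continuous_shiftMap) fun x => hb _
  have e : ∫ x, u (shiftMap x) ∂μ = ∫ x, u x ∂μ := by
    conv_rhs => rw [← hμ.2.map_eq,
      integral_map hμ.2.measurable.aemeasurable hu.aestronglyMeasurable]
  have h3 : Integrable (fun x => c - A x) μ := (integrable_const c).sub hi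
  have h4 : Integrable (fun x => c - A x - u x) μ := h3.sub h1
  refine ⟨h4.add h2, ?_⟩
  rw [integral_add h4 h2, integral_sub h3 h1, integral_sub (integrable_const c) hi, e]
  simp

theorem extIntegral_le (hμ : μ ∈ invariantProbs M) (hAc : Continuous A)
    (hAbdd : BddAbove (Set.range A)) (hu : Continuous u)
    (hb : ∀ x, u x ∈ Set.Icc 0 C) (hR : ∀ x, 0 ≤ c - A x - u x + u (shiftMap x)) :
    extIntegral A μ ≤ c := by
  have := hμ.1
  by_cases hi : Integrable A μ
  · rw [extIntegral_of_integrable hi, EReal.coe_le_coe_iff]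
    have h : 0 ≤ ∫ x, (c - A x - u x + u (shiftMap x)) ∂μ := integral_nonneg hR
    rw [(integral_defect hμ hu hb hi).2] at h
    linarith
  · rw [extIntegral_of_not_integrable hAc hAbdd hi]
    exact bot_le

/-- A nonnegative continuous defect with zero integral vanishes on the support, since its zero set
is closed. -/
theorem extIntegral_eq_iff (hμ : μ ∈ invariantProbs M) (hAc : Continuous A)
    (hAbdd : BddAbove (Set.range A)) (hu : Continuous u)
    (hb : ∀ x, u x ∈ Set.Icc 0 C) (hR : ∀ x, 0 ≤ c - A x - u x + u (shiftMap x)) :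
    extIntegral A μ = c ↔ ∀ x ∈ μ.support, c - A x - u x + u (shiftMap x) = 0 := by
  have := hμ.1
  have hus : Continuous fun x => u (shiftMap x) := hu.comp continuous_shiftMap
  constructor
  · intro h
    have hi : Integrable A μ := by
      by_contra hi
      rw [extIntegral_of_not_integrable hAc hAbdd hi] at h
      exact EReal.bot_ne_coe c h
    rw [extIntegral_of_integrable hi, EReal.coe_eq_coe_iff] at h
    obtain ⟨h1, h2⟩ := integral_defect (c := c) hμ hu hb hi
    rw [h, sub_self, integral_eq_zero_iff_of_nonneg hR h1] at h2
    exact Measure.support_subset_of_isClosed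
      (t := {x | c - A x - u x + u (shiftMap x) = 0})
      (isClosed_eq (by fun_prop) continuous_const) h2
  · intro h
    have h0 : ∀ᵐ x ∂μ, c - A x - u x + u (shiftMap x) = 0 := by
      filter_upwards [Measure.support_mem_ae (μ := μ)] with x hx using h x hx
    -- Almost everywhere `A = c - u + u ∘ σ`, which is bounded.
    have hi : Integrable A μ := by
      refine (((integrable_const c).sub (integrable_of_mem_Icc hu hb)).add
        (integrable_of_mem_Icc hus fun x => hb _)).congr ?_
      filter_upwards [h0] with x hx
      simp only [Pi.add_apply, Pi.sub_apply]
      linarith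
    have h2 := (integral_defect (c := c) hμ hu hb hi).2
    rw [integral_congr_ae (g := fun _ => (0 : ℝ)) h0, integral_zero] at h2
    rw [extIntegral_of_integrable hi, EReal.coe_eq_coe_iff]
    linarith

theorem shiftMap_mem_support (hμ : μ ∈ invariantProbs M) {x : Shift M} (hx : x ∈ μ.support) :
    shiftMap x ∈ μ.support := by
  rw [Measure.mem_support_iff_forall] at hx ⊢
  intro U hU
  obtain ⟨V, hVU, hV, hxV⟩ := mem_nhds_iff.1 hU
  have := hx _ (continuous_shiftMap.continuousAt (hV.mem_nhds hxV))
  rw [hμ.2.measure_preimage hV.measurableSet.nullMeasurableSet] at this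
  exact this.trans_le (measure_mono hVU)

theorem iterate_mem_support (hμ : μ ∈ invariantProbs M) {x : Shift M} (hx : x ∈ μ.support)
    (n : ℕ) : shiftMap^[n] x ∈ μ.support := by
  induction n with
  | zero => exact hx
  | succ n ih => rw [Function.iterate_succ_apply']; exact shiftMap_mem_support hμ ih

theorem birkhoffSum_sub_eq (n : ℕ) (y : Shift M) :
    birkhoffSum shiftMap (fun z => A z - c) n y = u (shiftMap^[n] y) - u y -
      birkhoffSum shiftMap (fun z => c - A z - u z + u (shiftMap z)) n y := by
  induction n with
  | zero => simp
  | succ n ih =>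
    rw [birkhoffSum_succ, birkhoffSum_succ, ih, Function.iterate_succ_apply']
    ring

/-- Recurrent points of the contact set are non-wandering. -/
theorem support_subset_nonWandering (h0 : 0 < lam) (h1 : lam < 1) (hμ : μ ∈ invariantProbs M)
    (hu : Continuous u) {I : ℕ} (hc : (betaFinite A I).toReal = c)
    (hR : ∀ x ∈ μ.support, c - A x - u x + u (shiftMap x) = 0)
    (hI : μ.support ⊆ finiteShift M I) : μ.support ⊆ nonWandering lam A I := by
  have := hμ.1
  intro x hx
  refine ⟨hI hx, fun ε hε => ?_⟩
  rw [hc]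
  obtain ⟨k, hk⟩ := exists_pow_lt_of_lt_one hε h1
  have hU : {y : Shift M | Agree k x y} ∩ u ⁻¹' Metric.ball (u x) (ε / 2) ∈ 𝓝 x :=
    inter_mem ((isOpen_setOf_agree x k).mem_nhds (fun _ _ => rfl))
      (hu.continuousAt (Metric.ball_mem_nhds _ (by positivity)))
  have hUo : IsOpen ({y : Shift M | Agree k x y} ∩ u ⁻¹' Metric.ball (u x) (ε / 2)) :=
    (isOpen_setOf_agree x k).inter (Metric.isOpen_ball.preimage hu)
  set U := {y : Shift M | Agree k x y} ∩ u ⁻¹' Metric.ball (u x) (ε / 2)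
  -- Recurrence is applied inside the support, so that the defect vanishes along the whole orbit of
  -- the returning point.
  have hpos : μ (U ∩ μ.support) ≠ 0 := by
    rw [measure_inter_conull Measure.measure_compl_support]
    exact (Measure.mem_support_iff_forall x |>.1 hx U hU).ne'
  obtain ⟨y, ⟨hyU, hyS⟩, n, hn, hnU, hnS⟩ := hμ.2.conservative.exists_mem_iterate_mem
    (hUo.measurableSet.inter Measure.isClosed_support.measurableSet).nullMeasurableSet hpos
  refine ⟨y, hI hyS, n, Nat.pos_of_ne_zero hn, (hyU.1.shiftDist_le h0 h1).trans_lt hk,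
    (hnU.1.shiftDist_le h0 h1).trans_lt hk, ?_⟩
  have hz : birkhoffSum shiftMap (fun z => c - A z - u z + u (shiftMap z)) n y = 0 :=
    Finset.sum_eq_zero fun j _ => hR _ (iterate_mem_support hμ hyS j)
  rw [birkhoffSum_sub_eq (u := u), hz, sub_zero, ← Real.dist_eq]
  calc _ ≤ dist (u (shiftMap^[n] y)) (u x) + dist (u y) (u x) := dist_triangle_right _ _ _
    _ < ε / 2 + ε / 2 := add_lt_add hnU.2 hyU.2
    _ = ε := by ring

/-- Non-wandering points lie in the contact set. -/
theorem defect_eq_zero_of_nonWandering (h0 : 0 < lam) (h1 : lam < 1) (hAc : Continuous A)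
    (hu : Continuous u) {I : ℕ} (hc : (betaFinite A I).toReal = c)
    (hR : ∀ x, 0 ≤ c - A x - u x + u (shiftMap x)) {x : Shift M}
    (hx : x ∈ nonWandering lam A I) : c - A x - u x + u (shiftMap x) = 0 := by
  have hus : Continuous fun x => u (shiftMap x) := hu.comp continuous_shiftMap
  have hRc : Continuous fun x => c - A x - u x + u (shiftMap x) := by fun_prop
  refine le_antisymm (le_of_forall_pos_lt_add fun ε hε => ?_) (hR x)
  -- Four errors of `ε / 4`: one from comparing the defects at `x` and `y`, two from `u` at `y` and
  -- `σ^n y`, one from the Birkhoff sum.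
  set U := (fun x => c - A x - u x + u (shiftMap x)) ⁻¹'
      Metric.ball (c - A x - u x + u (shiftMap x)) (ε / 4) ∩ u ⁻¹' Metric.ball (u x) (ε / 4)
  have hUo : IsOpen U := (Metric.isOpen_ball.preimage hRc).inter (Metric.isOpen_ball.preimage hu)
  have hxU : x ∈ U := ⟨Metric.mem_ball_self (by positivity), Metric.mem_ball_self (by positivity)⟩
  obtain ⟨δ, hδ, hδU⟩ := (isOpen_iff_shiftDist h0 h1 U).1 hUo x hxU
  obtain ⟨y, -, n, hn, hy, hny, hS⟩ := hx.2 (min δ (ε / 4)) (by positivity)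
  have hyU := hδU y (hy.trans_le (min_le_left _ _))
  have hnU := hδU _ (hny.trans_le (min_le_left _ _))
  have hS' := hS.trans_le (min_le_right _ _)
  rw [hc, birkhoffSum_sub_eq (u := u), abs_lt] at hS'
  -- Keep only the term `j = 0`, available because `n > 0`.
  have hle : c - A y - u y + u (shiftMap y) ≤
      birkhoffSum shiftMap (fun z => c - A z - u z + u (shiftMap z)) n y :=
    Finset.single_le_sum (f := fun j => (fun z => c - A z - u z + u (shiftMap z)) (shiftMap^[j] y))
      (fun j _ => hR _) (Finset.mem_range.2 hn)
  have e1 := abs_lt.1 (Real.dist_eq _ _ ▸ Metric.mem_ball.1 hyU.1)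
  have e2 := abs_lt.1 (Real.dist_eq _ _ ▸ Metric.mem_ball.1 hyU.2)
  have e3 := abs_lt.1 (Real.dist_eq _ _ ▸ Metric.mem_ball.1 hnU.2)
  linarith [e1.1, e2.1, e3.2, hS'.1]

end Cohomology

end MarkovShift

/-! ### The main theorem -/

theorem mainTheorem6 (M : ℕ → ℕ → Prop) (F : Finset ℕ) (K₀ : ℕ)
    (hM : MarkovShift.FinitelyPrimitiveWith M F K₀)
    (hF : (MarkovShift.cylinders M F).Nonempty)
    (lam : ℝ) (hlam0 : 0 < lam) (hlam1 : lam < 1)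
    (A : MarkovShift.Shift M → ℝ) (hAbdd : BddAbove (Set.range A))
    (hA : MarkovShift.LocallyHolder lam A)
    (Ihat : ℕ) (hIhat : F.sup id < Ihat)
    (hgap : (⨆ x ∈ MarkovShift.cylindersAbove M Ihat, (A x : EReal)) <
      ((sInf (A '' MarkovShift.cylinders M F) -
        ((MarkovShift.totalVariation lam A).toReal +
          K₀ * (sSup (Set.range A) - sInf (A '' MarkovShift.cylinders M F))) : ℝ) : EReal)) :
    MarkovShift.beta A = MarkovShift.betaFinite A Ihat ∧
    (∃ μ ∈ MarkovShift.finiteProbs M Ihat,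
      MarkovShift.extIntegral A μ = MarkovShift.betaFinite A Ihat) ∧
    ∀ μ ∈ MarkovShift.invariantProbs M,
      (MarkovShift.IsMaximizing A μ ↔ μ.support ⊆ MarkovShift.nonWandering lam A Ihat) := by
  open MarkovShift in
  have hgap' : ∀ x ∈ cylindersAbove M Ihat, A x < sInf (A '' cylinders M F) -
      ((totalVariation lam A).toReal +
        K₀ * (sSup (Set.range A) - sInf (A '' cylinders M F))) := fun x hx =>
    EReal.coe_lt_coe_iff.1 ((le_iSup₂ (f := fun x _ => (A x : EReal)) x hx).trans_lt hgap)
  have hAc := continuous_of_locallyHolder hlam0 hlam1 hA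
  set c := periodicValue A Ihat with hcdef
  have hc1 := sInf_le_periodicValue hlam0 hlam1 hA hAbdd hM hF hIhat.le
  have hC := birkhoffSum_sub_periodicValue_le hlam0 hlam1 hA hAbdd hM hF hIhat.le
    fun x hx => (hgap' x hx).le
  generalize (totalVariation lam A).toReal +
    K₀ * (sSup (Set.range A) - sInf (A '' cylinders M F)) = C at hgap' hC
  simp_rw [← hcdef, ← birkhoffSum_sub_const] at hC
  set u := subaction fun z => A z - c
  have hu : Continuous u := continuous_subaction hlam0 hlam1 hA hC
  have hb : ∀ x, u x ∈ Set.Icc 0 C := fun x => ⟨subaction_nonneg hC x, subaction_le hC x⟩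
  have hR : ∀ x, 0 ≤ c - A x - u x + u (shiftMap x) := fun x => by
    have : A x - c + u x ≤ u (shiftMap x) := add_subaction_le hC x
    linarith
  obtain ⟨p, hp, N, hN, hper, -⟩ := periodicAverages_nonempty hM hF hIhat.le
  obtain ⟨μ₀, hμ₀, hi₀, hmax⟩ := exists_finiteProbs_le_integral hAc hp hN hper
  have hle : ∀ μ ∈ invariantProbs M, extIntegral A μ ≤ c :=
    fun μ hμ => extIntegral_le hμ hAc hAbdd hu hb hR
  have hμ₀c : extIntegral A μ₀ = c := by
    refine le_antisymm (hle _ hμ₀.1) ?_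
    rw [extIntegral_of_integrable hi₀, EReal.coe_le_coe_iff]
    refine csSup_le ⟨_, p, hp, N, hN, hper, rfl⟩ ?_
    rintro _ ⟨q, hq, n, hn, hn', rfl⟩
    exact hmax q hq n hn hn'
  have hbF : betaFinite A Ihat = c :=
    le_antisymm (iSup₂_le fun μ hμ => hle μ hμ.1) (hμ₀c ▸ le_iSup₂_of_le μ₀ hμ₀ le_rfl)
  have hbeta : beta A = c :=
    le_antisymm (iSup₂_le hle) (hμ₀c ▸ le_iSup₂_of_le μ₀ hμ₀.1 le_rfl)
  have hcR : (betaFinite A Ihat).toReal = c := by rw [hbF, EReal.toReal_coe]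
  refine ⟨hbeta.trans hbF.symm, ⟨μ₀, hμ₀, hμ₀c.trans hbF.symm⟩, fun μ hμ => ?_⟩
  have hiff := extIntegral_eq_iff (c := c) hμ hAc hAbdd hu hb hR
  rw [IsMaximizing, hbeta, hiff]
  constructor
  · rintro ⟨-, h⟩
    refine support_subset_nonWandering hlam0 hlam1 hμ hu hcR h fun x hx j => ?_
    by_contra! hj
    -- A symbol above `Ihat` gives `A < inf A - C ≤ c - C` there, so the defect exceeds `C - u + u ∘
    -- σ ≥ 0` and cannot vanish.
    have h1 := hgap' (shiftMap^[j] x) (by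
      rw [mem_cylindersAbove, shiftMap_iterate_apply, zero_add]; exact hj)
    have h2 := h _ (iterate_mem_support hμ hx j)
    linarith [(hb (shiftMap^[j] x)).2, (hb (shiftMap (shiftMap^[j] x))).1]
  · intro h
    exact ⟨hμ, fun x hx => defect_eq_zero_of_nonWandering hlam0 hlam1 hAc hu hcR hR (h hx)⟩
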